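/- Let $n\ge 0$ be an integer and let $B$ be an analytic function on the open upper half-plane $\mathbb{C}_+$ with values in the complex $n\times n$ matrices, which is contractive: $\|B(w)\|\le 1$ for all $w\in\mathbb{C}_+$, in the Euclidean operator norm. Let $\alpha$ be a unitary $n\times n$ matrix such that $I-B(w)\alpha^*$ is invertible for every $w\in\mathbb{C}_+$. Let $\gamma(w)=\frac{w-i}{w+i}$ be the Cayley transform, let $b$ be the function on the unit disk $\mathbb{D}$ with $B=b\circ\gamma$, and put $h_\alpha(\zeta)=(I-b(\zeta)\alpha^*)^{-1}(I+b(\zeta)\alpha^*)$. The Clark measure $\mu^{b\alpha^*}$ on the unit circle $\mathbb{T}$ is the countably additive Borel measure with positive semidefinite matrix values for which $$\operatorname{Re} h_\alpha(\zeta)=\tfrac12\bigl(h_\alpha(\zeta)+h_\alpha(\zeta)^*\bigr)=\int_{\mathbb{T}}\frac{1-|\zeta|^2}{|\lambda-\zeta|^2}\,\mu^{b\alpha^*}(d\lambda)\qquad(\zeta\in\mathbb{D}),$$ and the Clark measure $\mu^{B\alpha^*}$ on $\mathbb{R}$ is $$\mu^{B\alpha^*}(\Omega)=\int_\Omega\frac{1}{\pi(1+t^2)}\,(\mu^{b\alpha^*}\circ\gamma)(dt)\qquad(\Omega\subseteq\mathbb{R}\text{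 Borel}),$$ where $(\mu^{b\alpha^*}\circ\gamma)(\Omega)=\mu^{b\alpha^*}(\gamma(\Omega))$. Then the Clark measure $\mu^{B\alpha^*}$ exists and is unique, and for every $s\in\mathbb{R}$ the limit below exists and $$\mu^{B\alpha^*}(\{s\})=\frac{2i}{\pi(1+s^2)^2}\,\lim_{w\downarrow s}(s-w)\,(I-B(w)\alpha^*)^{-1},$$ where $w\downarrow s$ means that $w\in\mathbb{C}_+$ tends to $s$ non-tangentially, that is, within each region $\{|\operatorname{Re}w-s|\le\kappa\operatorname{Im}w\}$ with $\kappa>0$. -/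

import Mathlib

open scoped Matrix Matrix.Norms.L2Operator Topology ComplexOrder

namespace MatrixClark

/-- The open upper half-plane. -/
def upperHalf : Set ℂ := {w : ℂ | 0 < w.im}

/-- The unit circle, with its Borel structure as a subspace of the plane. -/
abbrev UnitCircle : Type := Metric.sphere (0 : ℂ) 1

/-- The class of contractive analytic matrix functions on an open set `X` of the plane.
The norm on matrices is the operator norm on Euclidean space. -/
structure IsContractiveAnalytic {n : ℕ} (X : Set ℂ) (B : ℂ → Matrix (Fin n) (Fin n) ℂ) :
    Prop where
  analytic : DifferentiableOn ℂ B X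
  contractive : ∀ w ∈ X, ‖B w‖ ≤ 1

/-- The Cayley transform of the upper half-plane onto the unit disk. -/
noncomputable def cayley (w : ℂ) : ℂ := (w - Complex.I) / (w + Complex.I)

/-- The inverse of the Cayley transform. -/
noncomputable def cayleyInv (z : ℂ) : ℂ := Complex.I * (1 + z) / (1 - z)

/-- The function `(I - C)⁻¹ (I + C)`; here `C` is the function `z ↦ b(z) α*`. -/
noncomputable def herglotz {n : ℕ} (C : ℂ → Matrix (Fin n) (Fin n) ℂ) (z : ℂ) :
    Matrix (Fin n) (Fin n) ℂ :=
  (1 - C z)⁻¹ * (1 + C z)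

/-- `ν` is the Clark measure on the circle of the contractive function `C` on the disk: a
countably additive set function whose values are positive semidefinite matrices, and whose Poisson
integral is the real part of the function `(I - C)⁻¹ (I + C)`. -/
structure IsDiskClarkMeasure {n : ℕ} (C : ℂ → Matrix (Fin n) (Fin n) ℂ)
    (ν : MeasureTheory.VectorMeasure UnitCircle (Matrix (Fin n) (Fin n) ℂ)) : Prop where
  posSemidef : ∀ E : Set UnitCircle, MeasurableSet E → (ν E).PosSemidef
  poisson : ∀ z : ℂ, ‖z‖ < 1 →
    (2⁻¹ : ℂ) • (herglotz C z + (herglotz C z)ᴴ) =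
      ∫ᵛ l : UnitCircle, ((1 - ‖z‖ ^ 2) / ‖(l : ℂ) - z‖ ^ 2 : ℝ) ∂•ν

/-- The set function `Ω ↦ ν (γ(Ω))` on the line, where `γ` is the Cayley transform; the point `1`
of the circle, which is not in the image of the line, is removed first. -/
noncomputable def cayleyPullback {n : ℕ}
    (ν : MeasureTheory.VectorMeasure UnitCircle (Matrix (Fin n) (Fin n) ℂ)) :
    MeasureTheory.VectorMeasure ℝ (Matrix (Fin n) (Fin n) ℂ) :=
  (ν.restrict {l : UnitCircle | (l : ℂ) ≠ 1}).map (fun l : UnitCircle => (cayleyInv (l : ℂ)).re)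

theorem measurable_cayleyInv_re :
    Measurable (fun l : UnitCircle => (cayleyInv (l : ℂ)).re) := by
  unfold cayleyInv
  fun_prop

theorem cayley_mem_iff (l : UnitCircle) (t : ℝ) :
    (l : ℂ) = cayley t ↔ (l : ℂ) ≠ 1 ∧ (cayleyInv (l : ℂ)).re = t := by
  have hl : Complex.normSq (l : ℂ) = 1 := by
    have h := l.2
    rw [mem_sphere_zero_iff_norm] at h
    rw [Complex.normSq_eq_norm_sq, h, one_pow]
  have ht : (t : ℂ) + Complex.I ≠ 0 := by
    intro h
    have := congrArg Complex.im h
    simp at this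
  have hI := Complex.I_sq
  unfold cayley cayleyInv
  constructor
  · intro h
    have h1 : (l : ℂ) ≠ 1 := by
      rw [h]
      intro h2
      rw [div_eq_one_iff_eq ht] at h2
      have := congrArg Complex.im h2
      norm_num at this
    refine ⟨h1, ?_⟩
    have h2 : (1 : ℂ) - l ≠ 0 := sub_ne_zero.mpr (Ne.symm h1)
    have h3 : Complex.I * (1 + (l : ℂ)) / (1 - l) = t := by
      rw [div_eq_iff h2]
      rw [eq_div_iff ht] at h
      linear_combination h
    rw [h3, Complex.ofReal_re]
  · rintro ⟨h1, h2⟩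
    have h3 : (1 : ℂ) - l ≠ 0 := sub_ne_zero.mpr (Ne.symm h1)
    have him : (Complex.I * (1 + (l : ℂ)) / (1 - l)).im = 0 := by
      rw [Complex.div_im]
      rw [Complex.normSq_apply] at hl
      have : Complex.normSq (1 - (l : ℂ)) ≠ 0 := by simpa using h3
      field_simp
      simp
      linear_combination -hl
    have h4 : Complex.I * (1 + (l : ℂ)) / (1 - l) = t := by
      apply Complex.ext
      · simpa using h2
      · simpa using him
    rw [eq_div_iff ht]
    rw [div_eq_iff h3] at h4
    linear_combination h4

theorem cayleyPullback_apply {n : ℕ}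
    (ν : MeasureTheory.VectorMeasure UnitCircle (Matrix (Fin n) (Fin n) ℂ))
    {Ω : Set ℝ} (hΩ : MeasurableSet Ω) :
    cayleyPullback ν Ω = ν {l : UnitCircle | ∃ t ∈ Ω, (l : ℂ) = cayley t} := by
  have h1 : MeasurableSet {l : UnitCircle | (l : ℂ) ≠ 1} :=
    (measurableSet_eq_fun measurable_subtype_coe measurable_const).compl
  rw [cayleyPullback, MeasureTheory.VectorMeasure.map_apply _ measurable_cayleyInv_re hΩ,
    MeasureTheory.VectorMeasure.restrict_apply _ h1 (measurable_cayleyInv_re hΩ)]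
  congr 1
  ext l
  simp only [Set.mem_inter_iff, Set.mem_preimage, Set.mem_ofPred_eq, cayley_mem_iff]
  constructor
  · rintro ⟨h2, h3⟩
    exact ⟨_, h2, h3, rfl⟩
  · rintro ⟨t, ht, h3, rfl⟩
    exact ⟨ht, h3⟩

/-- `μ` is the Clark measure on the line of `B α*`: with `b` the function on the disk such that
`B = b ∘ γ`, and `ν` the Clark measure of `b α*` on the circle, it is given by
`μ(Ω) = ∫_Ω 1 / (π (1 + t²)) (ν ∘ γ)(dt)`. -/
def IsClarkMeasure {n : ℕ} (B : ℂ → Matrix (Fin n) (Fin n) ℂ) (α : Matrix (Fin n) (Fin n) ℂ)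
    (μ : MeasureTheory.VectorMeasure ℝ (Matrix (Fin n) (Fin n) ℂ)) : Prop :=
  ∃ ν : MeasureTheory.VectorMeasure UnitCircle (Matrix (Fin n) (Fin n) ℂ),
    IsDiskClarkMeasure (fun z => B (cayleyInv z) * αᴴ) ν ∧
    μ = (cayleyPullback ν).withDensity (fun t : ℝ => 1 / (Real.pi * (1 + t ^ 2)))
      (ContinuousLinearMap.lsmul ℝ ℝ)

/-- The function `f` on the upper half-plane has the non-tangential limit `L` at the point `s` of
the line. -/
def NontangentialTendsto {n : ℕ} (f : ℂ → Matrix (Fin n) (Fin n) ℂ) (s : ℝ)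
    (L : Matrix (Fin n) (Fin n) ℂ) : Prop :=
  ∀ κ : ℝ, 0 < κ →
    Filter.Tendsto f (𝓝[{w : ℂ | 0 < w.im ∧ |w.re - s| ≤ κ * w.im}] (s : ℂ)) (𝓝 L)

end MatrixClark

/-!
Since `C = B α*` is contractive, `H = (1 - C)⁻¹ (1 + C)` has positive semidefinite real part on the
disk. For each vector `v` the function `v* H v` is therefore, up to an imaginary constant, the
Herglotz integral of a positive measure: a weak limit of the densities `Re v* H(r l) v` as `r → 1`.
Polarization assembles these measures into the Clark measure, which is unique because the values of
a Poisson integral on a circle `|z| = r` determine the moments of the measure.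

Under the Cayley transform, `(s - w)` times the Herglotz kernel stays bounded as `w → s` inside a
Stolz angle and tends to `-i (1 + s²)` at the image of `s`, to `0` elsewhere. Dominated convergence
thus isolates the atom at `s`, and `(1 - C)⁻¹ = (H + 1) / 2` turns this into the limit formula.
-/

namespace MatrixClark

open MeasureTheory Filter Metric Complex

section VectorMeasure

variable {X F G : Type*} [MeasurableSpace X] [NormedAddCommGroup F] [NormedSpace ℝ F]
  [NormedAddCommGroup G] [NormedSpace ℝ G]

/-- The image of a vector measure under a continuous linear map of the values. -/
noncomputable def mapCLM (ν : VectorMeasure X F) (ℓ : F →L[ℝ] G) : VectorMeasure X G :=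
  ν.mapRange ℓ.toLinearMap.toAddMonoidHom ℓ.continuous

@[simp]
theorem mapCLM_apply (ν : VectorMeasure X F) (ℓ : F →L[ℝ] G) (E : Set X) :
    mapCLM ν ℓ E = ℓ (ν E) := rfl

theorem variation_mapCLM_le (ν : VectorMeasure X F) (ℓ : F →L[ℝ] G) :
    (mapCLM ν ℓ).variation ≤ ‖ℓ‖ₑ • ν.variation := by
  refine VectorMeasure.variation_le_of_forall_enorm_le fun E _ ↦ ?_
  calc ‖ℓ (ν E)‖ₑ ≤ ‖ℓ‖ₑ * ‖ν E‖ₑ := ℓ.le_opENorm _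
    _ ≤ ‖ℓ‖ₑ * ν.variation E := by
      gcongr
      exact VectorMeasure.enorm_measure_le_variation ν E

theorem integrable_mapCLM {ν : VectorMeasure X F} {f : X → ℝ} (hf : ν.Integrable f)
    (ℓ : F →L[ℝ] G) : (mapCLM ν ℓ).Integrable f :=
  (Integrable.smul_measure hf enorm_ne_top).mono_measure (variation_mapCLM_le ν ℓ)

theorem integral_mapCLM [CompleteSpace F] [CompleteSpace G] {ν : VectorMeasure X F} {f : X → ℝ}
    (hf : ν.Integrable f) (ℓ : F →L[ℝ] G) :
    ∫ᵛ x, f x ∂•(mapCLM ν ℓ) = ℓ (∫ᵛ x, f x ∂•ν) := by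
  have htranspose : (mapCLM ν ℓ).transpose (ContinuousLinearMap.lsmul ℝ ℝ) =
      ν.transpose ((ContinuousLinearMap.compL ℝ F F G ℓ) ∘L ContinuousLinearMap.lsmul ℝ ℝ) := by
    refine VectorMeasure.ext fun E _ ↦ ContinuousLinearMap.ext fun c ↦ ?_
    exact (map_smul ℓ c (ν E)).symm
  rw [VectorMeasure.continuousLinearMap_apply_integral hf,
    VectorMeasure.integral_eq_setToFun_transpose hf,
    VectorMeasure.integral_eq_setToFun_transpose (integrable_mapCLM hf ℓ)]
  simp only [htranspose]

theorem integral_smul_toSignedMeasure {m : Measure X} [IsFiniteMeasure m] (f : X → ℝ) :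
    ∫ᵛ x, f x ∂•m.toSignedMeasure = ∫ x, f x ∂m := by
  rw [← VectorMeasure.integral_toSignedMeasure]
  congr 1
  ext
  simp

theorem enorm_apply_le_sum_variation_coord {ι : Type*} [Fintype ι] [FiniteDimensional ℝ F]
    (b : Module.Basis ι ℝ F) (ν : VectorMeasure X F) (E : Set X) :
    ‖ν E‖ₑ ≤
      ∑ k, ‖b k‖ₑ * (mapCLM ν (b.coord k).toContinuousLinearMap).variation E :=
  calc ‖ν E‖ₑ = ‖∑ k, b.repr (ν E) k • b k‖ₑ := by rw [b.sum_repr]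
    _ ≤ ∑ k, ‖b.repr (ν E) k • b k‖ₑ := enorm_sum_le _ _
    _ ≤ _ := by
      gcongr with k
      rw [enorm_smul, mul_comm]
      gcongr
      exact VectorMeasure.enorm_measure_le_variation
        (mapCLM ν (b.coord k).toContinuousLinearMap) E

instance isFiniteMeasure_variation [FiniteDimensional ℝ F] (ν : VectorMeasure X F) :
    IsFiniteMeasure ν.variation := by
  let b := Module.finBasis ℝ F
  have hsigned (s : SignedMeasure X) : IsFiniteMeasure s.variation := by
    rw [← SignedMeasure.totalVariation_eq_variation, SignedMeasure.totalVariation]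
    infer_instance
  refine isFiniteMeasure_of_le
    (∑ k, ‖b k‖₊ • (mapCLM ν (b.coord k).toContinuousLinearMap).variation)
    (VectorMeasure.variation_le_of_forall_enorm_le fun E _ ↦ ?_)
  simpa [Measure.finsetSum_apply, enorm_eq_nnnorm] using enorm_apply_le_sum_variation_coord b ν E

theorem vectorMeasure_ext_dual [FiniteDimensional ℝ F] {ν₁ ν₂ : VectorMeasure X F}
    (h : ∀ ℓ : F →L[ℝ] ℝ, mapCLM ν₁ ℓ = mapCLM ν₂ ℓ) : ν₁ = ν₂ := by
  ext E _
  refine SeparatingDual.eq_iff_forall_dual_eq (R := ℝ) |>.mpr fun ℓ ↦ ?_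
  rw [← mapCLM_apply, h, mapCLM_apply]

end VectorMeasure

theorem integrable_of_continuous {X E : Type*} [MeasurableSpace X] [TopologicalSpace X]
    [CompactSpace X] [OpensMeasurableSpace X] [NormedAddCommGroup E] {m : Measure X}
    [IsFiniteMeasure m] {f : X → E} (hf : Continuous f) : Integrable f m :=
  hf.integrable_of_hasCompactSupport (HasCompactSupport.of_compactSpace f)

section UnitCircle

theorem norm_unitCircle (l : UnitCircle) : ‖(l : ℂ)‖ = 1 := mem_sphere_zero_iff_norm.mp l.2

theorem unitCircle_sub_ne_zero (l : UnitCircle) {z : ℂ} (hz : z ∈ ball 0 1) : (l : ℂ) - z ≠ 0 :=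
  fun h ↦ by simpa [sub_eq_zero.mp h ▸ norm_unitCircle l] using mem_ball_zero_iff.mp hz

theorem poissonKernel_unitCircle (z : ℂ) (l : UnitCircle) :
    poissonKernel 0 z l = (1 - ‖z‖ ^ 2) / ‖(l : ℂ) - z‖ ^ 2 := by
  simp [poissonKernel_def]

theorem poissonKernel_mul_comm (r : ℝ) (ω l : UnitCircle) :
    poissonKernel 0 (r * ω) l = poissonKernel 0 (r * l) ω := by
  have hdist : ‖(l : ℂ) - r * ω‖ ^ 2 = ‖(ω : ℂ) - r * l‖ ^ 2 := by
    have hnormSq : normSq (ω : ℂ) = normSq (l : ℂ) := by simp [normSq_eq_norm_sq]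
    simp only [normSq_apply] at hnormSq
    simp only [Complex.sq_norm, normSq_apply, sub_re, sub_im, re_ofReal_mul, im_ofReal_mul]
    linear_combination (r ^ 2 - 1) * hnormSq
  simp [poissonKernel_unitCircle, hdist]

theorem continuous_herglotzRieszKernel {z : ℂ} (hz : z ∈ ball 0 1) :
    Continuous fun l : UnitCircle ↦ herglotzRieszKernel 0 z l :=
  (continuousOn_herglotzRieszKernel_sphere hz).comp_continuous continuous_subtype_val fun l ↦ by
    simp

theorem continuous_poissonKernel {z : ℂ} (hz : z ∈ ball 0 1) :
    Continuous fun l : UnitCircle ↦ poissonKernel 0 z l := by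
  simpa only [poissonKernel_eq_re_herglotzRieszKernel] using!
    continuous_re.comp (continuous_herglotzRieszKernel hz)

/-- The parametrization of the unit circle by the angle. -/
noncomputable def circlePoint (θ : ℝ) : UnitCircle := ⟨circleMap 0 1 θ, by simp⟩

theorem continuous_circlePoint : Continuous circlePoint :=
  (continuous_circleMap 0 1).subtype_mk _

/-- The arc length on the unit circle, normalized to be a probability measure: integrals against it
are the circle averages `Real.circleAverage f 0 1`. -/
noncomputable def arcMeasure : Measure UnitCircle :=
  ENNReal.ofReal (2 * Real.pi)⁻¹ • (volume.restrict (Set.Ioc 0 (2 * Real.pi))).map circlePoint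

instance : IsFiniteMeasure arcMeasure :=
  Measure.smul_finite _ ENNReal.ofReal_ne_top

theorem integral_arcMeasure {E : Type*} [NormedAddCommGroup E] [NormedSpace ℝ E] {f : ℂ → E}
    (hf : Continuous fun l : UnitCircle ↦ f l) :
    ∫ l : UnitCircle, f l ∂arcMeasure = Real.circleAverage f 0 1 := by
  rw [arcMeasure, integral_smul_measure,
    integral_map continuous_circlePoint.aemeasurable hf.aestronglyMeasurable,
    Real.circleAverage_def, intervalIntegral.integral_of_le (by positivity),
    ENNReal.toReal_ofReal (by positivity)]
  rfl

end UnitCircle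

section PoissonIntegral

/-- The Poisson integral of a measure on the unit circle. -/
noncomputable def poissonIntegral (m : Measure UnitCircle) (z : ℂ) : ℝ :=
  ∫ l : UnitCircle, poissonKernel 0 z l ∂m

variable {m m₁ m₂ : Measure UnitCircle} [IsFiniteMeasure m] [IsFiniteMeasure m₁]
  [IsFiniteMeasure m₂]

theorem mul_unitCircle_mem_ball {r : ℝ} (hr : |r| < 1) (l : UnitCircle) :
    (r * l : ℂ) ∈ ball (0 : ℂ) 1 := by
  simpa [norm_unitCircle] using hr

theorem continuous_poissonKernel_mul {r : ℝ} (hr : |r| < 1) :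
    Continuous fun p : UnitCircle × UnitCircle ↦ poissonKernel 0 (r * p.1) p.2 := by
  simp only [poissonKernel_unitCircle]
  refine Continuous.div (by fun_prop) (by fun_prop) fun p ↦ ?_
  have := unitCircle_sub_ne_zero p.2 (mul_unitCircle_mem_ball hr p.1)
  positivity

theorem integral_poissonIntegral_mul_smul {E : Type*} [NormedAddCommGroup E] [NormedSpace ℂ E]
    [CompleteSpace E] {f : ℂ → E} (hf : DiffContOnCl ℂ f (ball 0 1)) {r : ℝ} (hr : |r| < 1) :
    ∫ ω : UnitCircle, poissonIntegral m (r * ω) • f ω ∂arcMeasure =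
      ∫ l : UnitCircle, f (r * l) ∂m := by
  have hf' : Continuous fun ω : UnitCircle ↦ f ω :=
    hf.continuousOn.comp_continuous continuous_subtype_val fun ω ↦ by
      simp [closure_ball]
  have hcont : Continuous fun p : UnitCircle × UnitCircle ↦ poissonKernel 0 (r * p.1) p.2 • f p.1 :=
    (continuous_poissonKernel_mul hr).smul (hf'.comp continuous_fst)
  simp_rw [poissonIntegral, ← integral_smul_const]
  rw [integral_integral_swap (integrable_of_continuous hcont)]
  congr 1 with l
  simp_rw [poissonKernel_mul_comm r _ l]
  have hl := mul_unitCircle_mem_ball hr l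
  exact (integral_arcMeasure ((continuous_poissonKernel hl).smul hf')).trans
    (hf.circleAverage_poissonKernel_smul hl)

theorem integral_pow_eq_of_poissonIntegral_eqOn
    (h : Set.EqOn (poissonIntegral m₁) (poissonIntegral m₂) (ball 0 1)) (k : ℕ) :
    ∫ l : UnitCircle, (l : ℂ) ^ k ∂m₁ = ∫ l : UnitCircle, (l : ℂ) ^ k ∂m₂ := by
  have hr : |(1 / 2 : ℝ)| < 1 := by norm_num [abs_of_pos]
  have hpow : DiffContOnCl ℂ (fun z : ℂ ↦ z ^ k) (ball 0 1) :=
    Differentiable.diffContOnCl (by fun_prop)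
  have hscaled := calc
    ∫ l : UnitCircle, (((1 / 2 : ℝ) : ℂ) * l) ^ k ∂m₁
      = ∫ ω : UnitCircle, poissonIntegral m₁ ((1 / 2 : ℝ) * ω) • (ω : ℂ) ^ k ∂arcMeasure :=
        (integral_poissonIntegral_mul_smul hpow hr).symm
    _ = ∫ ω : UnitCircle, poissonIntegral m₂ ((1 / 2 : ℝ) * ω) • (ω : ℂ) ^ k ∂arcMeasure := by
        simp_rw [fun ω ↦ h (mul_unitCircle_mem_ball hr ω)]
    _ = ∫ l : UnitCircle, (((1 / 2 : ℝ) : ℂ) * l) ^ k ∂m₂ :=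
        integral_poissonIntegral_mul_smul hpow hr
  simp_rw [mul_pow, integral_const_mul] at hscaled
  exact mul_left_cancel₀ (by norm_num) hscaled

theorem integral_zpow_eq_of_poissonIntegral_eqOn
    (h : Set.EqOn (poissonIntegral m₁) (poissonIntegral m₂) (ball 0 1)) (k : ℤ) :
    ∫ l : UnitCircle, (l : ℂ) ^ k ∂m₁ = ∫ l : UnitCircle, (l : ℂ) ^ k ∂m₂ := by
  have hconj (j : ℕ) (l : UnitCircle) : (l : ℂ) ^ (-(j : ℤ)) = starRingEnd ℂ ((l : ℂ) ^ j) := by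
    rw [zpow_neg, zpow_natCast, ← inv_pow, inv_eq_conj (norm_unitCircle l), map_pow]
  obtain ⟨j, rfl | rfl⟩ := k.eq_nat_or_neg
  · simpa only [zpow_natCast] using integral_pow_eq_of_poissonIntegral_eqOn h j
  · simp_rw [hconj, integral_conj, integral_pow_eq_of_poissonIntegral_eqOn h j]

/-- The coordinate function of the unit circle. -/
noncomputable def coordinate : BoundedContinuousFunction UnitCircle ℂ :=
  BoundedContinuousFunction.mkOfCompact ⟨fun l ↦ (l : ℂ), continuous_subtype_val⟩

theorem exists_zpow_of_mem_closure_coordinate {g : BoundedContinuousFunction UnitCircle ℂ}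
    (hg : g ∈ Submonoid.closure ({coordinate} ∪ star {coordinate})) :
    ∃ k : ℤ, ∀ l, g l = (l : ℂ) ^ k := by
  induction hg using Submonoid.closure_induction with
  | mem g hg =>
    rw [Set.star_singleton] at hg
    obtain rfl | rfl := hg
    · exact ⟨1, fun l ↦ (zpow_one _).symm⟩
    · exact ⟨-1, fun l ↦ by rw [zpow_neg_one, inv_eq_conj (norm_unitCircle l)]; rfl⟩
  | one => exact ⟨0, fun l ↦ (zpow_zero _).symm⟩
  | mul f g _ _ hf hg =>
    obtain ⟨j, hj⟩ := hf
    obtain ⟨k, hk⟩ := hg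
    refine ⟨j + k, fun l ↦ ?_⟩
    have hl : (l : ℂ) ≠ 0 := norm_ne_zero_iff.mp (by simp)
    rw [BoundedContinuousFunction.mul_apply, hj, hk, zpow_add₀ hl]

theorem integral_eq_of_mem_adjoin_coordinate
    (h : ∀ k : ℤ, ∫ l : UnitCircle, (l : ℂ) ^ k ∂m₁ = ∫ l : UnitCircle, (l : ℂ) ^ k ∂m₂)
    {g : BoundedContinuousFunction UnitCircle ℂ} (hg : g ∈ StarAlgebra.adjoin ℂ {coordinate}) :
    ∫ l, g l ∂m₁ = ∫ l, g l ∂m₂ := by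
  have hspan : g ∈ Submodule.span ℂ
      (Submonoid.closure ({coordinate} ∪ star {coordinate}) : Set _) := by
    rwa [← StarAlgebra.adjoin_eq_span]
  clear hg
  induction hspan using Submodule.span_induction with
  | mem g hg =>
    obtain ⟨k, hk⟩ := exists_zpow_of_mem_closure_coordinate hg
    simp_rw [hk, h]
  | zero => simp
  | add f g _ _ hf hg =>
    simp_rw [BoundedContinuousFunction.add_apply]
    rw [integral_add (f.integrable _) (g.integrable _),
      integral_add (f.integrable _) (g.integrable _), hf, hg]
  | smul a f _ hf => simp_rw [BoundedContinuousFunction.smul_apply, integral_smul, hf]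

theorem measure_ext_of_poissonIntegral_eqOn
    (h : Set.EqOn (poissonIntegral m₁) (poissonIntegral m₂) (ball 0 1)) : m₁ = m₂ := by
  refine ext_of_forall_mem_subalgebra_integral_eq_of_polish (𝕜 := ℂ)
    (A := StarAlgebra.adjoin ℂ {coordinate}) (fun x y hxy ↦ ?_) fun g hg ↦
      integral_eq_of_mem_adjoin_coordinate (integral_zpow_eq_of_poissonIntegral_eqOn h) hg
  exact ⟨coordinate, ⟨coordinate.toContinuousMap,
    ⟨coordinate, StarAlgebra.self_mem_adjoin_singleton ℂ _, rfl⟩, rfl⟩,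
    fun hcoord ↦ hxy (Subtype.ext hcoord)⟩

end PoissonIntegral

section VectorPoissonIntegral

variable {F G : Type*} [NormedAddCommGroup F] [NormedSpace ℝ F] [FiniteDimensional ℝ F]
  [NormedAddCommGroup G] [NormedSpace ℝ G] [FiniteDimensional ℝ G] {z : ℂ}

/-- The Poisson integral of a vector measure on the unit circle. -/
noncomputable def vectorPoissonIntegral {F : Type*} [NormedAddCommGroup F] [NormedSpace ℝ F]
    (ν : VectorMeasure UnitCircle F) (z : ℂ) : F :=
  ∫ᵛ l : UnitCircle, poissonKernel 0 z l ∂•ν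

theorem integrable_poissonKernel (ν : VectorMeasure UnitCircle F) (hz : z ∈ ball 0 1) :
    ν.Integrable fun l : UnitCircle ↦ poissonKernel 0 z l :=
  integrable_of_continuous (continuous_poissonKernel hz)

theorem vectorPoissonIntegral_toSignedMeasure (m : Measure UnitCircle) [IsFiniteMeasure m] :
    vectorPoissonIntegral m.toSignedMeasure z = poissonIntegral m z :=
  integral_smul_toSignedMeasure _

theorem vectorPoissonIntegral_mapCLM (ν : VectorMeasure UnitCircle F) (ℓ : F →L[ℝ] G)
    (hz : z ∈ ball 0 1) :
    vectorPoissonIntegral (mapCLM ν ℓ) z = ℓ (vectorPoissonIntegral ν z) :=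
  have := FiniteDimensional.complete ℝ F
  have := FiniteDimensional.complete ℝ G
  integral_mapCLM (integrable_poissonKernel ν hz) ℓ

theorem vectorPoissonIntegral_sub (ν₁ ν₂ : VectorMeasure UnitCircle F) (hz : z ∈ ball 0 1) :
    vectorPoissonIntegral (ν₁ - ν₂) z =
      vectorPoissonIntegral ν₁ z - vectorPoissonIntegral ν₂ z :=
  VectorMeasure.integral_sub_vectorMeasure (integrable_poissonKernel ν₁ hz)
    (integrable_poissonKernel ν₂ hz)

theorem vectorPoissonIntegral_sum {ι : Type*} [Fintype ι] (ν : ι → VectorMeasure UnitCircle F)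
    (hz : z ∈ ball 0 1) :
    vectorPoissonIntegral (∑ a, ν a) z = ∑ a, vectorPoissonIntegral (ν a) z :=
  VectorMeasure.integral_finsetSum_vectorMeasure fun a _ ↦ integrable_poissonKernel (ν a) hz

theorem signedMeasure_eq_zero_of_vectorPoissonIntegral_eqOn_zero
    {s : SignedMeasure UnitCircle} (h : Set.EqOn (vectorPoissonIntegral s) 0 (ball 0 1)) :
    s = 0 := by
  let j := s.toJordanDecomposition
  have hs : s = j.posPart.toSignedMeasure - j.negPart.toSignedMeasure :=
    s.toSignedMeasure_toJordanDecomposition.symm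
  have hparts : j.posPart = j.negPart := by
    refine measure_ext_of_poissonIntegral_eqOn fun z hz ↦ ?_
    have hsub := h hz
    rw [hs, vectorPoissonIntegral_sub _ _ hz, vectorPoissonIntegral_toSignedMeasure,
      vectorPoissonIntegral_toSignedMeasure] at hsub
    exact sub_eq_zero.mp hsub
  rw [hs, sub_eq_zero]
  simp only [hparts]

theorem vectorMeasure_ext_of_vectorPoissonIntegral_eqOn {ν₁ ν₂ : VectorMeasure UnitCircle F}
    (h : Set.EqOn (vectorPoissonIntegral ν₁) (vectorPoissonIntegral ν₂) (ball 0 1)) :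
    ν₁ = ν₂ := by
  refine vectorMeasure_ext_dual fun ℓ ↦ sub_eq_zero.mp <|
    signedMeasure_eq_zero_of_vectorPoissonIntegral_eqOn_zero fun z hz ↦ ?_
  rw [vectorPoissonIntegral_sub _ _ hz, vectorPoissonIntegral_mapCLM _ _ hz,
    vectorPoissonIntegral_mapCLM _ _ hz, h hz, sub_self, Pi.zero_apply]

end VectorPoissonIntegral

section Harmonic

open InnerProductSpace

theorem poissonKernel_mul_mul {r : ℝ} (hr : r ≠ 0) (z w : ℂ) :
    poissonKernel 0 (r * z) (r * w) = poissonKernel 0 z w := by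
  simp only [poissonKernel_def, sub_zero, ← mul_sub, norm_mul, mul_pow]
  exact mul_div_mul_left _ _ (by simpa using hr)

theorem poissonIntegral_zero (m : Measure UnitCircle) : poissonIntegral m 0 = m.real Set.univ := by
  simp [poissonIntegral, poissonKernel_unitCircle]

theorem circleAverage_poissonKernel_smul_dilation {u : ℂ → ℝ} (hu : HarmonicOnNhd u (ball 0 1))
    {r : ℝ} (hr : r ∈ Set.Ioo 0 1) {z : ℂ} (hz : z ∈ ball 0 1) :
    Real.circleAverage (fun w ↦ poissonKernel 0 z w • u (r * w)) 0 1 = u (r * z) := by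
  have hrz : (r * z : ℂ) ∈ ball 0 r := by
    simpa [abs_of_pos hr.1, hr.1] using hz
  have hmean := (hu.mono (closedBall_subset_ball hr.2)).circleAverage_poissonKernel_smul hrz
  rw [Real.circleAverage_eq_circleAverage_zero_one] at hmean
  simpa [poissonKernel_mul_mul hr.1.ne'] using hmean

theorem exists_poissonIntegral_eq_dilation {u : ℂ → ℝ} (hu : HarmonicOnNhd u (ball 0 1))
    (hu₀ : ∀ z ∈ ball 0 1, 0 ≤ u z) {r : ℝ} (hr : r ∈ Set.Ioo 0 1) :
    ∃ m : FiniteMeasure UnitCircle, ∀ z ∈ ball 0 1, poissonIntegral m z = u (r * z) := by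
  have hball (l : UnitCircle) : (r * l : ℂ) ∈ ball 0 1 :=
    mul_unitCircle_mem_ball (by rw [abs_of_pos hr.1]; exact hr.2) l
  have hcont : Continuous fun l : UnitCircle ↦ u (r * l) :=
    hu.contDiffOn.continuousOn.comp_continuous (by fun_prop) hball
  let g : UnitCircle → NNReal := fun l ↦ (u (r * l)).toNNReal
  have hg : Continuous g := continuous_real_toNNReal.comp hcont
  have hfinite : IsFiniteMeasure (arcMeasure.withDensity fun l ↦ g l) :=
    isFiniteMeasure_withDensity_ofReal (integrable_of_continuous hcont).2
  refine ⟨⟨_, hfinite⟩, fun z hz ↦ ?_⟩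
  calc ∫ l : UnitCircle, poissonKernel 0 z l ∂arcMeasure.withDensity (fun l ↦ g l)
      = ∫ l : UnitCircle, poissonKernel 0 z l • u (r * l) ∂arcMeasure := by
        rw [integral_withDensity_eq_integral_smul hg.measurable]
        congr 1 with l
        rw [NNReal.smul_def, Real.coe_toNNReal _ (hu₀ _ (hball l)), smul_eq_mul, smul_eq_mul,
          mul_comm]
    _ = u (r * z) := by
        rw [integral_arcMeasure (f := fun w ↦ poissonKernel 0 z w • u (r * w))
          ((continuous_poissonKernel hz).smul hcont),
          circleAverage_poissonKernel_smul_dilation hu hr hz]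

theorem exists_tendsto_hyperfilter_of_mass_le {m : ℕ → FiniteMeasure UnitCircle} {C : NNReal}
    (hC : ∀ k, (m k).mass ≤ C) :
    ∃ m' : FiniteMeasure UnitCircle, Tendsto m (hyperfilter ℕ) (𝓝 m') := by
  obtain ⟨m', -, hm'⟩ := (isCompact_setOfPred_finiteMeasure_le_of_compactSpace UnitCircle
    C).ultrafilter_le_nhds ((hyperfilter ℕ).map m)
    (le_principal_iff.mpr (Eventually.of_forall (p := fun k ↦ m k ∈ _) hC))
  exact ⟨m', hm'⟩

theorem exists_poissonIntegral_eqOn {u : ℂ → ℝ} (hu : HarmonicOnNhd u (ball 0 1))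
    (hu₀ : ∀ z ∈ ball 0 1, 0 ≤ u z) :
    ∃ m : FiniteMeasure UnitCircle, Set.EqOn (poissonIntegral m) u (ball 0 1) := by
  obtain ⟨r, -, hr, hr_lim⟩ := exists_seq_strictMono_tendsto' (zero_lt_one' ℝ)
  choose m hm using fun k ↦ exists_poissonIntegral_eq_dilation hu hu₀ (hr k)
  have hmass (k : ℕ) : (m k).mass ≤ (u 0).toNNReal := by
    have hzero := hm k 0 (by simp)
    rw [poissonIntegral_zero, mul_zero] at hzero
    rw [← hzero]
    exact (Real.toNNReal_coe (r := (m k).mass)).ge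
  obtain ⟨m', hm'⟩ := exists_tendsto_hyperfilter_of_mass_le hmass
  refine ⟨m', fun z hz ↦ ?_⟩
  have hweak : Tendsto (fun k ↦ poissonIntegral (m k) z) (hyperfilter ℕ)
      (𝓝 (poissonIntegral m' z)) :=
    FiniteMeasure.tendsto_iff_forall_integral_tendsto.mp hm'
      (BoundedContinuousFunction.mkOfCompact ⟨_, continuous_poissonKernel hz⟩)
  simp_rw [hm _ z hz] at hweak
  have hdilation : Tendsto (fun k ↦ (r k : ℂ) * z) atTop (𝓝 z) := by
    simpa using ((continuous_ofReal.tendsto 1).comp hr_lim).mul_const z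
  exact tendsto_nhds_unique hweak <|
    ((hu z hz).1.continuousAt.tendsto.comp hdilation).mono_left Nat.hyperfilter_le_atTop

end Harmonic

section HerglotzIntegral

variable {m : Measure UnitCircle} [IsFiniteMeasure m]

/-- The Herglotz integral of a measure on the unit circle: an analytic function on the disk whose
real part is the Poisson integral of the measure. -/
noncomputable def herglotzIntegral (m : Measure UnitCircle) (z : ℂ) : ℂ :=
  ∫ l : UnitCircle, herglotzRieszKernel 0 z l ∂m

theorem re_herglotzIntegral {z : ℂ} (hz : z ∈ ball 0 1) :
    (herglotzIntegral m z).re = poissonIntegral m z := by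
  rw [poissonIntegral, poissonKernel_eq_re_herglotzRieszKernel]
  exact (reCLM.integral_comp_comm
    (integrable_of_continuous (continuous_herglotzRieszKernel hz))).symm

theorem hasDerivAt_herglotzRieszKernel {z l : ℂ} (h : l - z ≠ 0) :
    HasDerivAt (fun z ↦ herglotzRieszKernel 0 z l) (2 * l / (l - z) ^ 2) z := by
  simp only [herglotzRieszKernel_def, sub_zero]
  refine HasDerivAt.congr_deriv
    (((hasDerivAt_id' z).const_add l).fun_div ((hasDerivAt_id' z).const_sub l) h) ?_
  ring

theorem one_sub_norm_le_norm_unitCircle_sub (l : UnitCircle) (z : ℂ) :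
    1 - ‖z‖ ≤ ‖(l : ℂ) - z‖ := by
  simpa only [norm_unitCircle] using norm_sub_norm_le (l : ℂ) z

theorem norm_deriv_herglotzRieszKernel_le (l : UnitCircle) {z : ℂ} {ρ : ℝ} (hρ : ρ < 1)
    (hz : ‖z‖ ≤ ρ) : ‖2 * (l : ℂ) / (l - z) ^ 2‖ ≤ 2 / (1 - ρ) ^ 2 := by
  have hdist : 1 - ρ ≤ ‖(l : ℂ) - z‖ :=
    (sub_le_sub_left hz 1).trans (one_sub_norm_le_norm_unitCircle_sub l z)
  have := sub_pos.mpr hρ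
  rw [norm_div, norm_mul, norm_unitCircle, norm_pow, mul_one, RCLike.norm_ofNat]
  gcongr

theorem differentiableOn_herglotzIntegral : DifferentiableOn ℂ (herglotzIntegral m) (ball 0 1) := by
  intro z₀ hz₀
  obtain ⟨ρ, hz₀ρ, hρ⟩ := exists_between (mem_ball_zero_iff.mp hz₀)
  have hsub : ball (0 : ℂ) ρ ⊆ ball 0 1 := ball_subset_ball hρ.le
  have hmem : ball (0 : ℂ) ρ ∈ 𝓝 z₀ := isOpen_ball.mem_nhds (mem_ball_zero_iff.mpr hz₀ρ)
  have hderiv_cont : Continuous fun l : UnitCircle ↦ 2 * (l : ℂ) / (l - z₀) ^ 2 :=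
    Continuous.div (by fun_prop) (by fun_prop) fun l ↦ pow_ne_zero 2 (unitCircle_sub_ne_zero l hz₀)
  refine (hasDerivAt_integral_of_dominated_loc_of_deriv_le hmem
    (eventually_of_mem hmem fun z hz ↦
      (continuous_herglotzRieszKernel (hsub hz)).aestronglyMeasurable)
    (integrable_of_continuous (continuous_herglotzRieszKernel hz₀))
    hderiv_cont.aestronglyMeasurable
    (.of_forall fun l z hz ↦ norm_deriv_herglotzRieszKernel_le l hρ (mem_ball_zero_iff.mp hz).le)
    (integrable_const _)
    (.of_forall fun l z hz ↦ hasDerivAt_herglotzRieszKernel (unitCircle_sub_ne_zero l (hsub hz)))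
    ).2.differentiableAt.differentiableWithinAt

theorem exists_eqOn_herglotzIntegral_add_const {f : ℂ → ℂ} (hf : DifferentiableOn ℂ f (ball 0 1))
    (hm : Set.EqOn (poissonIntegral m) (fun z ↦ (f z).re) (ball 0 1)) :
    ∃ c : ℂ, Set.EqOn f (fun z ↦ herglotzIntegral m z + c) (ball 0 1) := by
  obtain ⟨c, hc⟩ := ((hf.sub (differentiableOn_herglotzIntegral (m := m))).analyticOnNhd
    isOpen_ball).eq_const_of_re_eq_const (c₀ := 0)
    (fun z hz ↦ by rw [Pi.sub_apply, sub_re, re_herglotzIntegral hz, hm hz, sub_self])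
    isOpen_ball ((convex_ball (0 : ℂ) 1).isConnected ⟨0, by simp⟩)
  exact ⟨c, fun z hz ↦ sub_eq_iff_eq_add'.mp (hc z hz)⟩

end HerglotzIntegral

section Cayley

theorem add_I_ne_zero {w : ℂ} (hw : 0 ≤ w.im) : w + I ≠ 0 := fun h ↦ by
  have him : w.im + 1 = 0 := by simpa using congrArg im h
  linarith

theorem one_sub_norm_cayley_sq {w : ℂ} (hw : w + I ≠ 0) :
    1 - ‖cayley w‖ ^ 2 = 4 * w.im / ‖w + I‖ ^ 2 := by
  have hnorm : ‖w + I‖ ^ 2 ≠ 0 := by positivity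
  rw [cayley, norm_div, div_pow, eq_div_iff hnorm, sub_mul, div_mul_cancel₀ _ hnorm,
    Complex.sq_norm, Complex.sq_norm, normSq_apply, normSq_apply]
  simp only [add_re, add_im, sub_re, sub_im, I_re, I_im]
  ring

theorem cayley_mem_ball {w : ℂ} (hw : 0 < w.im) : cayley w ∈ ball 0 1 := by
  have hI := add_I_ne_zero hw.le
  have hpos : 0 < 1 - ‖cayley w‖ ^ 2 := by
    rw [one_sub_norm_cayley_sq hI]
    positivity
  rw [mem_ball_zero_iff]
  nlinarith [norm_nonneg (cayley w)]

/-- The Cayley transform of a point of the line, as a point of the unit circle. -/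
noncomputable def cayleyCircle (t : ℝ) : UnitCircle :=
  ⟨cayley t, mem_sphere_zero_iff_norm.mpr <| by
    have hnorm := one_sub_norm_cayley_sq (add_I_ne_zero (ofReal_im t).ge)
    rw [ofReal_im, mul_zero, zero_div, sub_eq_zero] at hnorm
    exact (pow_eq_one_iff_of_nonneg (norm_nonneg _) two_ne_zero).mp hnorm.symm⟩

theorem continuousAt_cayley {w : ℂ} (hw : w + I ≠ 0) : ContinuousAt cayley w :=
  ContinuousAt.div (by fun_prop) (by fun_prop) hw

theorem mul_herglotzRieszKernel_cayley_cayley {a b : ℂ} (ha : a + I ≠ 0) (hb : b + I ≠ 0)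
    (hab : a ≠ b) :
    (a - b) * herglotzRieszKernel 0 (cayley b) (cayley a) = -I * (1 + a * b) := by
  have hsub : cayley a - cayley b = 2 * I * (a - b) / ((a + I) * (b + I)) := by
    rw [cayley, cayley]
    field_simp
    ring
  have hadd : cayley a + cayley b = 2 * (1 + a * b) / ((a + I) * (b + I)) := by
    rw [cayley, cayley]
    field_simp
    linear_combination -2 * I_sq
  have hab' : a - b ≠ 0 := sub_ne_zero.mpr hab
  rw [herglotzRieszKernel_def, sub_zero, sub_zero, hsub, hadd]
  field_simp
  rw [I_sq]
  ring

theorem cayleyInv_cayley {w : ℂ} (hw : w + I ≠ 0) : cayleyInv (cayley w) = w := by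
  have hsub : 1 - cayley w = 2 * I / (w + I) := by
    rw [cayley]
    field_simp
    ring
  have hadd : 1 + cayley w = 2 * w / (w + I) := by
    rw [cayley]
    field_simp
    ring
  rw [cayleyInv, hsub, hadd]
  field_simp

theorem one_sub_ne_zero_of_mem_ball {z : ℂ} (hz : z ∈ ball 0 1) : 1 - z ≠ 0 :=
  unitCircle_sub_ne_zero ⟨1, by simp⟩ hz

theorem im_cayleyInv (z : ℂ) : (cayleyInv z).im = (1 - ‖z‖ ^ 2) / ‖1 - z‖ ^ 2 := by
  rw [cayleyInv, div_im, ← sub_div, Complex.sq_norm, Complex.sq_norm, normSq_apply z]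
  congr 1
  simp only [mul_im, mul_re, add_re, add_im, sub_re, sub_im, I_re, I_im, one_re, one_im]
  ring

theorem mapsTo_cayleyInv : Set.MapsTo cayleyInv (ball 0 1) upperHalf := fun z hz ↦ by
  have hne := one_sub_ne_zero_of_mem_ball hz
  have hnorm : 0 < 1 - ‖z‖ ^ 2 := by
    nlinarith [norm_nonneg z, mem_ball_zero_iff.mp hz]
  change 0 < (cayleyInv z).im
  rw [im_cayleyInv]
  positivity

theorem differentiableOn_cayleyInv : DifferentiableOn ℂ cayleyInv (ball 0 1) :=
  DifferentiableOn.div (by fun_prop) (by fun_prop) fun _ ↦ one_sub_ne_zero_of_mem_ball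

end Cayley

section NontangentialLimit

variable {s κ : ℝ}

/-- The non-tangential approach region of aperture `κ` at the point `s` of the line. -/
def stolzAngle (s κ : ℝ) : Set ℂ := {w : ℂ | 0 < w.im ∧ |w.re - s| ≤ κ * w.im}

theorem norm_sub_le_of_mem_stolzAngle {w : ℂ} (hw : w ∈ stolzAngle s κ) :
    ‖(s : ℂ) - w‖ ≤ (κ + 1) * w.im := by
  refine (norm_le_abs_re_add_abs_im _).trans ?_
  simp only [sub_re, sub_im, ofReal_re, ofReal_im, zero_sub, abs_neg, abs_of_pos hw.1,
    abs_sub_comm s]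
  linarith [hw.2]

theorem norm_herglotzRieszKernel_cayley_le (l : UnitCircle) {w : ℂ} (hw : 0 < w.im) :
    ‖herglotzRieszKernel 0 (cayley w) l‖ ≤ ‖w + I‖ ^ 2 / w.im := by
  have hI := add_I_ne_zero hw.le
  have hlt := mem_ball_zero_iff.mp (cayley_mem_ball hw)
  have hdist : 2 * w.im / ‖w + I‖ ^ 2 ≤ ‖(l : ℂ) - cayley w‖ :=
    calc 2 * w.im / ‖w + I‖ ^ 2 = (1 - ‖cayley w‖ ^ 2) / 2 := by
          rw [one_sub_norm_cayley_sq hI]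
          ring
      _ ≤ 1 - ‖cayley w‖ := by nlinarith [norm_nonneg (cayley w)]
      _ ≤ ‖(l : ℂ) - cayley w‖ := one_sub_norm_le_norm_unitCircle_sub l _
  have hnum : ‖(l : ℂ) + cayley w‖ ≤ 2 :=
    (norm_add_le _ _).trans (by rw [norm_unitCircle]; linarith)
  rw [herglotzRieszKernel_def, sub_zero, sub_zero, norm_div]
  calc ‖(l : ℂ) + cayley w‖ / ‖(l : ℂ) - cayley w‖ ≤ 2 / (2 * w.im / ‖w + I‖ ^ 2) := by gcongr
    _ = ‖w + I‖ ^ 2 / w.im := by field_simp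

theorem norm_mul_herglotzRieszKernel_cayley_le (l : UnitCircle) {w : ℂ}
    (hw : w ∈ stolzAngle s κ) :
    ‖((s : ℂ) - w) * herglotzRieszKernel 0 (cayley w) l‖ ≤ (κ + 1) * ‖w + I‖ ^ 2 := by
  have him : w.im ≠ 0 := hw.1.ne'
  rw [norm_mul]
  calc ‖(s : ℂ) - w‖ * ‖herglotzRieszKernel 0 (cayley w) l‖
      ≤ ((κ + 1) * w.im) * (‖w + I‖ ^ 2 / w.im) :=
        mul_le_mul (norm_sub_le_of_mem_stolzAngle hw) (norm_herglotzRieszKernel_cayley_le l hw.1)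
          (norm_nonneg _) ((norm_nonneg _).trans (norm_sub_le_of_mem_stolzAngle hw))
    _ = (κ + 1) * ‖w + I‖ ^ 2 := by field_simp

theorem tendsto_mul_herglotzRieszKernel_cayleyCircle :
    Tendsto (fun w ↦ ((s : ℂ) - w) * herglotzRieszKernel 0 (cayley w) (cayleyCircle s))
      (𝓝[stolzAngle s κ] (s : ℂ)) (𝓝 (-I * (1 + (s : ℂ) ^ 2))) := by
  have hcont : ContinuousAt (fun w : ℂ ↦ -I * (1 + s * w)) (s : ℂ) := by fun_prop
  rw [pow_two]
  refine (hcont.tendsto.mono_left nhdsWithin_le_nhds).congr' ?_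
  filter_upwards [self_mem_nhdsWithin] with w hw
  refine (mul_herglotzRieszKernel_cayley_cayley (add_I_ne_zero (ofReal_im s).ge)
    (add_I_ne_zero hw.1.le) ?_).symm
  rintro rfl
  exact hw.1.ne' (ofReal_im s)

theorem tendsto_mul_herglotzRieszKernel_of_ne {l : UnitCircle} (hl : l ≠ cayleyCircle s) :
    Tendsto (fun w ↦ ((s : ℂ) - w) * herglotzRieszKernel 0 (cayley w) l)
      (𝓝[stolzAngle s κ] (s : ℂ)) (𝓝 0) := by
  have hne : (l : ℂ) - cayley s ≠ 0 := sub_ne_zero.mpr fun h ↦ hl (Subtype.ext h)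
  have hcay : ContinuousAt cayley (s : ℂ) := continuousAt_cayley (add_I_ne_zero (ofReal_im s).ge)
  have hcont : ContinuousAt (fun w : ℂ ↦ ((s : ℂ) - w) * herglotzRieszKernel 0 (cayley w) l)
      (s : ℂ) := by
    simp only [herglotzRieszKernel_def, sub_zero]
    fun_prop (disch := exact hne)
  simpa only [sub_self, zero_mul] using hcont.tendsto.mono_left nhdsWithin_le_nhds

theorem tendsto_mul_herglotzIntegral_cayley (m : Measure UnitCircle) [IsFiniteMeasure m] :
    Tendsto (fun w ↦ ((s : ℂ) - w) * herglotzIntegral m (cayley w)) (𝓝[stolzAngle s κ] (s : ℂ))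
      (𝓝 (-I * (1 + (s : ℂ) ^ 2) * m.real {cayleyCircle s})) := by
  have hlim := tendsto_integral_filter_of_norm_le_const (μ := m) (l := 𝓝[stolzAngle s κ] (s : ℂ))
    (F := fun w l ↦ ((s : ℂ) - w) * herglotzRieszKernel 0 (cayley w) l)
    (f := ({cayleyCircle s} : Set UnitCircle).indicator fun _ ↦ -I * (1 + (s : ℂ) ^ 2)) ?_ ?_ ?_
  · rw [integral_indicator_const _ (measurableSet_singleton _), real_smul, mul_comm] at hlim
    simpa only [herglotzIntegral, integral_const_mul] using hlim
  · filter_upwards [self_mem_nhdsWithin] with w hw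
    exact ((continuous_herglotzRieszKernel (cayley_mem_ball hw.1)).const_mul _).aestronglyMeasurable
  · have hcont : ContinuousAt (fun w : ℂ ↦ (κ + 1) * ‖w + I‖ ^ 2) (s : ℂ) := by fun_prop
    refine ⟨(κ + 1) * ‖(s : ℂ) + I‖ ^ 2 + 1, ?_⟩
    filter_upwards [self_mem_nhdsWithin,
      nhdsWithin_le_nhds (hcont.eventually (gt_mem_nhds (lt_add_one _)))] with w hw hbound
    exact .of_forall fun l ↦ (norm_mul_herglotzRieszKernel_cayley_le l hw).trans hbound.le
  · refine .of_forall fun l ↦ ?_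
    by_cases hl : l = cayleyCircle s
    · rw [hl, Set.indicator_of_mem (Set.mem_singleton _)]
      exact tendsto_mul_herglotzRieszKernel_cayleyCircle
    · rw [Set.indicator_of_notMem (Set.notMem_singleton_iff.mpr hl)]
      exact tendsto_mul_herglotzRieszKernel_of_ne hl

theorem tendsto_sub_smul_const_zero {E : Type*} [NormedAddCommGroup E] [NormedSpace ℂ E] (c : E) :
    Tendsto (fun w ↦ ((s : ℂ) - w) • c) (𝓝[stolzAngle s κ] (s : ℂ)) (𝓝 0) := by
  have hcont : ContinuousAt (fun w : ℂ ↦ ((s : ℂ) - w) • c) (s : ℂ) := by fun_prop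
  simpa only [sub_self, zero_smul] using hcont.tendsto.mono_left nhdsWithin_le_nhds

theorem tendsto_mul_comp_cayley {f : ℂ → ℂ} (hf : DifferentiableOn ℂ f (ball 0 1))
    {m : Measure UnitCircle} [IsFiniteMeasure m]
    (hm : Set.EqOn (poissonIntegral m) (fun z ↦ (f z).re) (ball 0 1)) :
    Tendsto (fun w ↦ ((s : ℂ) - w) * f (cayley w)) (𝓝[stolzAngle s κ] (s : ℂ))
      (𝓝 (-I * (1 + (s : ℂ) ^ 2) * m.real {cayleyCircle s})) := by
  obtain ⟨c, hc⟩ := exists_eqOn_herglotzIntegral_add_const hf hm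
  have hlim := (tendsto_mul_herglotzIntegral_cayley (s := s) (κ := κ) m).add
    (tendsto_sub_smul_const_zero c)
  rw [add_zero] at hlim
  refine hlim.congr' ?_
  filter_upwards [self_mem_nhdsWithin] with w hw
  rw [hc (cayley_mem_ball hw.1), mul_add, smul_eq_mul]

end NontangentialLimit

section QuadraticForm

variable {ι : Type*} [Fintype ι]

/-- The value `v* A v` of the quadratic form of a matrix, as a linear functional of the matrix. -/
noncomputable def quadForm (v : ι → ℂ) : Matrix ι ι ℂ →L[ℂ] ℂ :=
  LinearMap.toContinuousLinearMap
    { toFun := fun A ↦ star v ⬝ᵥ A *ᵥ v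
      map_add' := fun A B ↦ by rw [Matrix.add_mulVec, dotProduct_add]
      map_smul' := fun c A ↦ by rw [Matrix.smul_mulVec, dotProduct_smul, RingHom.id_apply] }

theorem quadForm_apply (v : ι → ℂ) (A : Matrix ι ι ℂ) : quadForm v A = star v ⬝ᵥ A *ᵥ v := rfl

theorem quadForm_conjTranspose (v : ι → ℂ) (A : Matrix ι ι ℂ) :
    quadForm v Aᴴ = star (quadForm v A) := by
  rw [quadForm_apply, quadForm_apply, Matrix.star_dotProduct, Matrix.star_mulVec,
    Matrix.conjTranspose_conjTranspose, Matrix.dotProduct_mulVec]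

/-- The Hermitian part of a square matrix. -/
noncomputable def hermitianPart (A : Matrix ι ι ℂ) : Matrix ι ι ℂ := (2⁻¹ : ℂ) • (A + Aᴴ)

theorem quadForm_hermitianPart (v : ι → ℂ) (A : Matrix ι ι ℂ) :
    quadForm v (hermitianPart A) = ((quadForm v A).re : ℂ) := by
  rw [hermitianPart, map_smul, map_add, quadForm_conjTranspose, star_def, add_conj, smul_eq_mul,
    ofReal_mul, ofReal_ofNat, inv_mul_cancel_left₀ two_ne_zero]

/-- The vector `e_j + i ^ k e_i` of the polarization identity, for `a = ((i, j), k)`. -/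
noncomputable def polarVec [DecidableEq ι] (a : (ι × ι) × Fin 4) : ι → ℂ :=
  Pi.single a.1.2 1 + I ^ (a.2 : ℕ) • Pi.single a.1.1 1

/-- The coefficient `i ^ k / 4 E_ij` with which the value of a quadratic form at `polarVec a`
enters the polarization identity, for `a = ((i, j), k)`. -/
noncomputable def polarMat [DecidableEq ι] (a : (ι × ι) × Fin 4) : Matrix ι ι ℂ :=
  (I ^ (a.2 : ℕ) / 4) • Matrix.single a.1.1 a.1.2 1

theorem quadForm_single_add [DecidableEq ι] (A : Matrix ι ι ℂ) (i j : ι) (c : ℂ) :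
    quadForm (Pi.single j 1 + c • Pi.single i 1) A =
      A j j + c * A j i + star c * A i j + star c * c * A i i := by
  rw [quadForm_apply]
  simp only [star_add, star_smul, Matrix.mulVec_add, Matrix.mulVec_smul, dotProduct_add,
    add_dotProduct, smul_dotProduct, dotProduct_smul, ← Pi.single_star, star_one,
    single_one_dotProduct, Matrix.mulVec_single_one, Matrix.col_apply, smul_eq_mul]
  ring

theorem sum_quadForm_polarVec_mul [DecidableEq ι] (A : Matrix ι ι ℂ) (i j : ι) :
    ∑ k : Fin 4, quadForm (polarVec ((i, j), k)) A * (I ^ (k : ℕ) / 4) = A i j := by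
  simp only [polarVec, quadForm_single_add, Fin.sum_univ_four, Fin.coe_ofNat_eq_mod, Nat.reduceMod,
    pow_zero, pow_one, I_sq, I_pow_three, star_def, map_one, map_neg, conj_I]
  linear_combination ((A j i - A i j) / 2) * I_sq

theorem sum_quadForm_smul_polarMat [DecidableEq ι] (A : Matrix ι ι ℂ) :
    ∑ a, quadForm (polarVec a) A • polarMat a = A := by
  conv_rhs => rw [Matrix.matrix_eq_sum_single A, ← Fintype.sum_prod_type']
  rw [Fintype.sum_prod_type]
  refine Finset.sum_congr rfl fun p _ ↦ ?_
  simp only [polarMat, smul_smul]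
  rw [← Finset.sum_smul, sum_quadForm_polarVec_mul A p.1 p.2, Matrix.smul_single, smul_eq_mul,
    mul_one]

theorem ext_quadForm {A B : Matrix ι ι ℂ} (h : ∀ v, quadForm v A = quadForm v B) : A = B := by
  classical
  rw [← sum_quadForm_smul_polarMat A, ← sum_quadForm_smul_polarMat B]
  simp only [h]

theorem posSemidef_of_quadForm_nonneg {A : Matrix ι ι ℂ} (h : ∀ v, 0 ≤ quadForm v A) :
    A.PosSemidef :=
  .of_dotProduct_mulVec_nonneg (ext_quadForm fun v ↦ by
    rw [quadForm_conjTranspose, (IsSelfAdjoint.of_nonneg (h v)).star_eq]) h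

theorem re_star_sub_dotProduct_add (x y : ι → ℂ) :
    (star (x - y) ⬝ᵥ (x + y)).re = ‖WithLp.toLp 2 x‖ ^ 2 - ‖WithLp.toLp 2 y‖ ^ 2 := by
  rw [dotProduct_comm, ← EuclideanSpace.inner_toLp_toLp, WithLp.toLp_sub, WithLp.toLp_add,
    inner_sub_left, inner_add_right, inner_add_right, sub_re, add_re, add_re]
  have hsymm := inner_re_symm (𝕜 := ℂ) (WithLp.toLp 2 x) (WithLp.toLp 2 y)
  have hx := inner_self_eq_norm_sq (𝕜 := ℂ) (WithLp.toLp 2 x)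
  have hy := inner_self_eq_norm_sq (𝕜 := ℂ) (WithLp.toLp 2 y)
  simp only [RCLike.re_to_complex] at hsymm hx hy
  linarith

theorem re_quadForm_inv_mul_nonneg [DecidableEq ι] {C : Matrix ι ι ℂ} (hC : ‖C‖ ≤ 1)
    (hinv : IsUnit (1 - C)) (v : ι → ℂ) : 0 ≤ (quadForm v ((1 - C)⁻¹ * (1 + C))).re := by
  have hdet : IsUnit (1 - C).det := (Matrix.isUnit_iff_isUnit_det _).mp hinv
  obtain ⟨x, rfl⟩ : ∃ x, v = (1 - C) *ᵥ x :=
    ⟨(1 - C)⁻¹ *ᵥ v, by rw [Matrix.mulVec_mulVec, Matrix.mul_nonsing_inv _ hdet,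
      Matrix.one_mulVec]⟩
  have hcomm : (1 + C) * (1 - C) = (1 - C) * (1 + C) := by noncomm_ring
  have hcancel : ((1 - C)⁻¹ * (1 + C)) *ᵥ ((1 - C) *ᵥ x) = (1 + C) *ᵥ x := by
    rw [Matrix.mulVec_mulVec, mul_assoc, hcomm, Matrix.nonsing_inv_mul_cancel_left _ _ hdet]
  have hnorm : ‖WithLp.toLp 2 (C *ᵥ x)‖ ≤ ‖WithLp.toLp 2 x‖ :=
    (Matrix.l2_opNorm_mulVec C (WithLp.toLp 2 x)).trans
      (mul_le_of_le_one_left (norm_nonneg _) hC)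
  rw [quadForm_apply, hcancel, Matrix.sub_mulVec, Matrix.add_mulVec, Matrix.one_mulVec,
    re_star_sub_dotProduct_add, sub_nonneg]
  gcongr

end QuadraticForm

section Caratheodory

variable {ι : Type*} [Fintype ι] {H : ℂ → Matrix ι ι ℂ}

/-- The matrix Carathéodory class: analytic functions on the unit disk whose real part is positive
semidefinite. -/
structure IsCaratheodory (H : ℂ → Matrix ι ι ℂ) : Prop where
  analytic : DifferentiableOn ℂ H (ball 0 1)
  re_quadForm_nonneg : ∀ z ∈ ball (0 : ℂ) 1, ∀ v, 0 ≤ (quadForm v (H z)).re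

namespace IsCaratheodory

theorem differentiableOn_quadForm (hH : IsCaratheodory H) (v : ι → ℂ) :
    DifferentiableOn ℂ (fun z ↦ quadForm v (H z)) (ball 0 1) := by
  classical
  exact (quadForm v).differentiable.comp_differentiableOn hH.analytic

theorem exists_poissonIntegral_eqOn (hH : IsCaratheodory H) (v : ι → ℂ) :
    ∃ m : FiniteMeasure UnitCircle,
      Set.EqOn (poissonIntegral m) (fun z ↦ (quadForm v (H z)).re) (ball 0 1) :=
  MatrixClark.exists_poissonIntegral_eqOn
    (fun z hz ↦ ((hH.differentiableOn_quadForm v).analyticOnNhd isOpen_ball z hz).harmonicAt_re)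
    fun z hz ↦ hH.re_quadForm_nonneg z hz v

theorem exists_vectorPoissonIntegral_eqOn [DecidableEq ι] (hH : IsCaratheodory H) :
    ∃ ν : VectorMeasure UnitCircle (Matrix ι ι ℂ),
      Set.EqOn (vectorPoissonIntegral ν) (fun z ↦ hermitianPart (H z)) (ball 0 1) := by
  choose m hm using hH.exists_poissonIntegral_eqOn
  refine ⟨∑ a, mapCLM (m (polarVec a) : Measure UnitCircle).toSignedMeasure
    (ContinuousLinearMap.toSpanSingleton ℝ (polarMat a)), fun z hz ↦ ?_⟩
  beta_reduce
  rw [vectorPoissonIntegral_sum _ hz, ← sum_quadForm_smul_polarMat (hermitianPart (H z))]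
  refine Finset.sum_congr rfl fun a _ ↦ ?_
  rw [vectorPoissonIntegral_mapCLM _ _ hz, vectorPoissonIntegral_toSignedMeasure, hm _ hz,
    ContinuousLinearMap.toSpanSingleton_apply, quadForm_hermitianPart, coe_smul]

end IsCaratheodory

variable [DecidableEq ι] {ν : VectorMeasure UnitCircle (Matrix ι ι ℂ)}

theorem mapCLM_quadForm_eq
    (hν : Set.EqOn (vectorPoissonIntegral ν) (fun z ↦ hermitianPart (H z)) (ball 0 1))
    {v : ι → ℂ} {m : Measure UnitCircle} [IsFiniteMeasure m]
    (hm : Set.EqOn (poissonIntegral m) (fun z ↦ (quadForm v (H z)).re) (ball 0 1)) :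
    mapCLM ν ((quadForm v).restrictScalars ℝ) = mapCLM m.toSignedMeasure ofRealCLM := by
  refine vectorMeasure_ext_of_vectorPoissonIntegral_eqOn fun z hz ↦ ?_
  rw [vectorPoissonIntegral_mapCLM _ _ hz, vectorPoissonIntegral_mapCLM _ _ hz,
    vectorPoissonIntegral_toSignedMeasure, hν hz, hm hz]
  exact quadForm_hermitianPart v (H z)

theorem quadForm_vectorMeasure_apply
    (hν : Set.EqOn (vectorPoissonIntegral ν) (fun z ↦ hermitianPart (H z)) (ball 0 1))
    {v : ι → ℂ} {m : Measure UnitCircle} [IsFiniteMeasure m]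
    (hm : Set.EqOn (poissonIntegral m) (fun z ↦ (quadForm v (H z)).re) (ball 0 1))
    {E : Set UnitCircle} (hE : MeasurableSet E) : quadForm v (ν E) = (m.real E : ℂ) := by
  rw [← Measure.toSignedMeasure_apply_measurable hE]
  exact DFunLike.congr_fun (mapCLM_quadForm_eq hν hm) E

namespace IsCaratheodory

theorem posSemidef_apply (hH : IsCaratheodory H)
    (hν : Set.EqOn (vectorPoissonIntegral ν) (fun z ↦ hermitianPart (H z)) (ball 0 1))
    {E : Set UnitCircle} (hE : MeasurableSet E) : (ν E).PosSemidef := by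
  refine posSemidef_of_quadForm_nonneg fun v ↦ ?_
  obtain ⟨m, hm⟩ := hH.exists_poissonIntegral_eqOn v
  rw [quadForm_vectorMeasure_apply hν hm hE]
  exact_mod_cast measureReal_nonneg

theorem tendsto_smul_comp_cayley (hH : IsCaratheodory H)
    (hν : Set.EqOn (vectorPoissonIntegral ν) (fun z ↦ hermitianPart (H z)) (ball 0 1))
    (s κ : ℝ) :
    Tendsto (fun w ↦ ((s : ℂ) - w) • H (cayley w)) (𝓝[stolzAngle s κ] (s : ℂ))
      (𝓝 ((-I * (1 + (s : ℂ) ^ 2)) • ν {cayleyCircle s})) := by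
  have hquad (v : ι → ℂ) : Tendsto (fun w ↦ quadForm v (((s : ℂ) - w) • H (cayley w)))
      (𝓝[stolzAngle s κ] (s : ℂ))
      (𝓝 (quadForm v ((-I * (1 + (s : ℂ) ^ 2)) • ν {cayleyCircle s}))) := by
    obtain ⟨m, hm⟩ := hH.exists_poissonIntegral_eqOn v
    simp only [map_smul, quadForm_vectorMeasure_apply hν hm (measurableSet_singleton _)]
    exact tendsto_mul_comp_cayley (hH.differentiableOn_quadForm v) hm
  simpa only [sum_quadForm_smul_polarMat] using
    tendsto_finsetSum Finset.univ fun a _ ↦ (hquad (polarVec a)).smul_const (polarMat a)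

end IsCaratheodory

end Caratheodory

section ClarkMeasure

variable {n : ℕ} {C : ℂ → Matrix (Fin n) (Fin n) ℂ} {X : Set ℂ}
  {ν : VectorMeasure UnitCircle (Matrix (Fin n) (Fin n) ℂ)}

theorem differentiableOn_herglotz (hC : DifferentiableOn ℂ C X)
    (hinv : ∀ z ∈ X, IsUnit (1 - C z)) : DifferentiableOn ℂ (herglotz C) X := by
  have hinverse (z : ℂ) (hz : z ∈ X) : DifferentiableAt ℂ Ring.inverse (1 - C z) :=
    differentiableAt_inverse (hinv z hz)
  have hresolvent : DifferentiableOn ℂ (fun z ↦ (1 - C z)⁻¹) X := fun z hz ↦ by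
    simp only [Matrix.nonsing_inv_eq_ringInverse]
    exact (hinverse z hz).comp_differentiableWithinAt (f := fun z ↦ 1 - C z) z
      ((hC z hz).const_sub 1)
  exact hresolvent.mul (hC.const_add 1)

theorem herglotz_eq_two_smul_inv_sub_one {z : ℂ} (hinv : IsUnit (1 - C z)) :
    herglotz C z = (2 : ℂ) • (1 - C z)⁻¹ - 1 := by
  have hadd : 1 + C z = (2 : ℂ) • 1 - (1 - C z) := by
    rw [two_smul]
    abel
  rw [herglotz, hadd, mul_sub, mul_smul_comm, mul_one,
    Matrix.nonsing_inv_mul _ ((Matrix.isUnit_iff_isUnit_det _).mp hinv)]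

theorem IsContractiveAnalytic.isCaratheodory_herglotz (hC : IsContractiveAnalytic (ball 0 1) C)
    (hinv : ∀ z ∈ ball (0 : ℂ) 1, IsUnit (1 - C z)) : IsCaratheodory (herglotz C) where
  analytic := differentiableOn_herglotz hC.analytic hinv
  re_quadForm_nonneg z hz := re_quadForm_inv_mul_nonneg (hC.contractive z hz) (hinv z hz)

theorem IsContractiveAnalytic.comp_cayleyInv (hC : IsContractiveAnalytic upperHalf C) :
    IsContractiveAnalytic (ball 0 1) (fun z ↦ C (cayleyInv z)) where
  analytic := hC.analytic.comp differentiableOn_cayleyInv mapsTo_cayleyInv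
  contractive _ hz := hC.contractive _ (mapsTo_cayleyInv hz)

theorem IsDiskClarkMeasure.eqOn (hν : IsDiskClarkMeasure C ν) :
    Set.EqOn (vectorPoissonIntegral ν) (fun z ↦ hermitianPart (herglotz C z)) (ball 0 1) :=
  fun z hz ↦ by
    simpa only [vectorPoissonIntegral, hermitianPart, poissonKernel_unitCircle] using
      (hν.poisson z (mem_ball_zero_iff.mp hz)).symm

theorem isDiskClarkMeasure_of_eqOn (hC : IsCaratheodory (herglotz C))
    (hν : Set.EqOn (vectorPoissonIntegral ν) (fun z ↦ hermitianPart (herglotz C z)) (ball 0 1)) :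
    IsDiskClarkMeasure C ν where
  posSemidef _ hE := hC.posSemidef_apply hν hE
  poisson z hz := by
    simpa only [vectorPoissonIntegral, hermitianPart, poissonKernel_unitCircle] using
      (hν (mem_ball_zero_iff.mpr hz)).symm

theorem existsUnique_isDiskClarkMeasure (hC : IsCaratheodory (herglotz C)) :
    ∃! ν, IsDiskClarkMeasure C ν := by
  obtain ⟨ν, hν⟩ := hC.exists_vectorPoissonIntegral_eqOn
  exact ⟨ν, isDiskClarkMeasure_of_eqOn hC hν, fun ν' hν' ↦
    vectorMeasure_ext_of_vectorPoissonIntegral_eqOn (hν'.eqOn.trans hν.symm)⟩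

theorem IsDiskClarkMeasure.tendsto_smul_inv (hC : IsCaratheodory (herglotz C))
    (hinv : ∀ z ∈ ball (0 : ℂ) 1, IsUnit (1 - C z)) (hν : IsDiskClarkMeasure C ν) (s κ : ℝ) :
    Tendsto (fun w ↦ ((s : ℂ) - w) • (1 - C (cayley w))⁻¹) (𝓝[stolzAngle s κ] (s : ℂ))
      (𝓝 ((2⁻¹ : ℂ) • (-I * (1 + (s : ℂ) ^ 2)) • ν {cayleyCircle s})) := by
  have hlim := ((hC.tendsto_smul_comp_cayley hν.eqOn s κ).add
    (tendsto_sub_smul_const_zero 1)).const_smul (2⁻¹ : ℂ)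
  rw [add_zero] at hlim
  refine hlim.congr' ?_
  filter_upwards [self_mem_nhdsWithin] with w hw
  rw [herglotz_eq_two_smul_inv_sub_one (hinv _ (cayley_mem_ball hw.1)), ← smul_add,
    sub_add_cancel, smul_comm, inv_smul_smul₀ two_ne_zero]

theorem integrable_cauchyDensity {F : Type*} [NormedAddCommGroup F] [NormedSpace ℝ F]
    [FiniteDimensional ℝ F] (μ : VectorMeasure ℝ F) :
    μ.Integrable fun t : ℝ ↦ 1 / (Real.pi * (1 + t ^ 2)) := by
  have hcont : Continuous fun t : ℝ ↦ 1 / (Real.pi * (1 + t ^ 2)) :=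
    Continuous.div (by fun_prop) (by fun_prop) fun t ↦ by positivity
  refine Integrable.of_bound hcont.aestronglyMeasurable 1 (.of_forall fun t ↦ ?_)
  rw [Real.norm_of_nonneg (by positivity), div_le_one (by positivity)]
  nlinarith [Real.two_le_pi, sq_nonneg t]

theorem cayleyPullback_singleton (s : ℝ) : cayleyPullback ν {s} = ν {cayleyCircle s} := by
  rw [cayleyPullback_apply ν (measurableSet_singleton s)]
  congr 1
  ext l
  simp [cayleyCircle, Subtype.ext_iff]

theorem withDensity_cayleyPullback_singleton (s : ℝ) :
    (cayleyPullback ν).withDensity (fun t : ℝ ↦ 1 / (Real.pi * (1 + t ^ 2)))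
      (ContinuousLinearMap.lsmul ℝ ℝ) {s} =
      (1 / (Real.pi * (1 + s ^ 2))) • ν {cayleyCircle s} := by
  rw [VectorMeasure.withDensity_apply (integrable_cauchyDensity _),
    VectorMeasure.integral_singleton, cayleyPullback_singleton, ContinuousLinearMap.lsmul_apply]

theorem ofReal_cauchyDensity_eq (s : ℝ) :
    ((1 / (Real.pi * (1 + s ^ 2)) : ℝ) : ℂ) =
      (2 * I) / ((Real.pi : ℂ) * (1 + (s : ℂ) ^ 2) ^ 2) * 2⁻¹ * (-I * (1 + (s : ℂ) ^ 2)) := by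
  have hs : (1 : ℂ) + (s : ℂ) ^ 2 ≠ 0 := by exact_mod_cast (by positivity : 1 + s ^ 2 ≠ 0)
  have hpi : (Real.pi : ℂ) ≠ 0 := ofReal_ne_zero.mpr Real.pi_ne_zero
  push_cast
  field_simp
  linear_combination I_sq

end ClarkMeasure

end MatrixClark

theorem mainTheorem2_general {n : ℕ} (B : ℂ → Matrix (Fin n) (Fin n) ℂ)
    (α : Matrix (Fin n) (Fin n) ℂ)
    (hC : MatrixClark.IsContractiveAnalytic MatrixClark.upperHalf fun w ↦ B w * αᴴ)
    (hinv : ∀ w ∈ MatrixClark.upperHalf, IsUnit (1 - B w * αᴴ)) :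
    (∃! μ : MeasureTheory.VectorMeasure ℝ (Matrix (Fin n) (Fin n) ℂ),
        MatrixClark.IsClarkMeasure B α μ) ∧
    ∀ μ : MeasureTheory.VectorMeasure ℝ (Matrix (Fin n) (Fin n) ℂ),
      MatrixClark.IsClarkMeasure B α μ →
      ∀ s : ℝ, ∃ L : Matrix (Fin n) (Fin n) ℂ,
        MatrixClark.NontangentialTendsto
          (fun w : ℂ => ((s : ℂ) - w) • (1 - B w * αᴴ)⁻¹) s L ∧
        μ {s} = ((2 * Complex.I) / ((Real.pi : ℂ) * (1 + (s : ℂ) ^ 2) ^ 2)) • L := by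
  open MatrixClark in
  have hinvDisk : ∀ z ∈ Metric.ball (0 : ℂ) 1, IsUnit (1 - B (cayleyInv z) * αᴴ) :=
    fun z hz ↦ hinv _ (mapsTo_cayleyInv hz)
  have hH := hC.comp_cayleyInv.isCaratheodory_herglotz hinvDisk
  constructor
  · obtain ⟨ν, hν, hunique⟩ := existsUnique_isDiskClarkMeasure hH
    refine ⟨_, ⟨ν, hν, rfl⟩, ?_⟩
    rintro _ ⟨ν', hν', rfl⟩
    rw [hunique ν' hν']
  · rintro _ ⟨ν, hν, rfl⟩ s
    refine ⟨_, fun κ _ ↦ (hν.tendsto_smul_inv hH hinvDisk s κ).congr' ?_, ?_⟩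
    · filter_upwards [self_mem_nhdsWithin] with w hw
      simp only [cayleyInv_cayley (add_I_ne_zero hw.1.le)]
    · rw [withDensity_cayleyPullback_singleton, smul_smul, smul_smul, ← ofReal_cauchyDensity_eq,
        Complex.coe_smul]

theorem mainTheorem2 {n : ℕ} (B : ℂ → Matrix (Fin n) (Fin n) ℂ)
    (hB : MatrixClark.IsContractiveAnalytic MatrixClark.upperHalf B)
    (α : Matrix (Fin n) (Fin n) ℂ) (hα : α ∈ Matrix.unitaryGroup (Fin n) ℂ)
    (hinv : ∀ w ∈ MatrixClark.upperHalf, IsUnit (1 - B w * αᴴ)) :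
    (∃! μ : MeasureTheory.VectorMeasure ℝ (Matrix (Fin n) (Fin n) ℂ),
        MatrixClark.IsClarkMeasure B α μ) ∧
    ∀ μ : MeasureTheory.VectorMeasure ℝ (Matrix (Fin n) (Fin n) ℂ),
      MatrixClark.IsClarkMeasure B α μ →
      ∀ s : ℝ, ∃ L : Matrix (Fin n) (Fin n) ℂ,
        MatrixClark.NontangentialTendsto
          (fun w : ℂ => ((s : ℂ) - w) • (1 - B w * αᴴ)⁻¹) s L ∧
        μ {s} = ((2 * Complex.I) / ((Real.pi : ℂ) * (1 + (s : ℂ) ^ 2) ^ 2)) • L :=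
  mainTheorem2_general B α ⟨hB.analytic.mul_const _, fun w hw ↦
    (CStarRing.norm_mul_mem_unitary _ (Unitary.star_mem hα)).trans_le (hB.contractive w hw)⟩ hinv
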